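/- Let $\mathbb T=\{z\in\mathbb C:|z|=1\}$ and, for $a\in\mathbb R$, let $R_a:\mathbb T\to\mathbb T$ be the rotation $R_a z=e^{2\pi\imath a}z$. For $\alpha\in\mathbb R$ let $\mathbb A_\alpha$ be the noncommutative $2$-torus, i.e. the universal unital $C^*$-algebra generated by two unitaries $U,V$ subject to $UV=e^{2\pi\imath\alpha}VU$. Let $\theta\in\mathbb R$ with $\theta/2\pi$ irrational, let $f:\mathbb T\to\mathbb T$ be continuous, and let $\Phi_{\theta,f}$ be the Anzai skew-product, i.e. the unique $*$-automorphism of $\mathbb A_\alpha$ with $$\Phi_{\theta,f}(U)=e^{\imath\theta}U,\qquad \Phi_{\theta,f}(V)=f(U)V,$$ where $f(U)$ is given by the continuous functional calculus. For $n\in\mathbb Z$ define $f_n:\mathbb T\to\mathbb T$ by $f_n:=\prod_{l=0}^{n-1}f\circ R_{-l\alpha}$ for $n>0$, $f_0:=1$, and $f_n:=\prod_{l=1}^{|n|}\overline{f\circ R_{l\alpha}}$ for $n<0$. Then the fixed-point subalgebra $(\mathbb A_\alpha)^{\Phi_{\theta,f}}=\{a\in\mathbb A_\alpha : \Phi_{\theta,f}(a)=a\}$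 equals $\mathbb C\,1_{\mathbb A_\alpha}$ (that is, the system $(\mathbb A_\alpha,\Phi_{\theta,f})$ is topologically ergodic) if and only if, for every $n\in\mathbb Z\smallsetminus\{0\}$, the equation $$(g\circ R_{\theta/2\pi})\,f_n=g$$ has no non-zero solution $g\in C(\mathbb T)$. -/

import Mathlib

open scoped ENNReal ComplexConjugate

noncomputable section

namespace NCTorus

/-! ### Functions of a unitary -/

/-- The continuous function `C(𝕋, 𝕋)` regarded as a complex valued one. -/
def toComplex (f : C(Circle, Circle)) : C(Circle, ℂ) :=
  ⟨fun z => (f z : ℂ), continuous_subtype_val.comp f.continuous⟩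

/-- `h(u)` for `h ∈ C(𝕋)` and `u` a unitary of a C⋆-algebra, by the continuous functional calculus.
The functional calculus of Mathlib takes a function on `ℂ` and only looks at its values on the
spectrum of `u`, which is contained in `𝕋`; so the (zero) extension off `𝕋` plays no role. -/
def funOf {B : Type*} [CStarAlgebra B] (h : C(Circle, ℂ)) (u : B) : B :=
  cfc (Function.extend (fun z : Circle => (z : ℂ)) h 0) u

/-- The rotation `R_a z = e^{2πia} z` of the circle. -/
def rot (a : ℝ) (z : Circle) : Circle := Circle.exp (2 * Real.pi * a) * z

theorem extend_coe (h : C(Circle, ℂ)) (z : Circle) :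
    Function.extend (fun z : Circle => (z : ℂ)) h 0 (z : ℂ) = h z :=
  Circle.coe_injective.extend_apply (f := fun z : Circle => (z : ℂ)) h 0 z

theorem mem_circle_of_spectrum {B : Type*} [CStarAlgebra B] {u : B} (hu : u ∈ unitary B)
    {z : ℂ} (hz : z ∈ spectrum ℂ u) : ∃ w : Circle, (w : ℂ) = z := by
  have h := spectrum.subset_circle_of_unitary hu hz
  rw [mem_sphere_zero_iff_norm] at h
  exact ⟨⟨z, mem_sphere_zero_iff_norm.2 h⟩, rfl⟩

theorem continuousOn_extend (h : C(Circle, ℂ)) :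
    ContinuousOn (Function.extend (fun z : Circle => (z : ℂ)) h 0) (Metric.sphere (0 : ℂ) 1) := by
  rw [continuousOn_iff_continuous_domRestrict]
  refine (h.continuous.comp (f := fun z : Metric.sphere (0 : ℂ) 1 => (⟨z.1, by
    have := z.2; rw [mem_sphere_zero_iff_norm] at this
    exact mem_sphere_zero_iff_norm.2 this⟩ : Circle)) ?_).congr ?_
  · exact Continuous.subtype_mk continuous_subtype_val _
  · intro z
    exact (extend_coe h ⟨z.1, _⟩).symm

theorem continuousOn_spectrum {B : Type*} [CStarAlgebra B] (h : C(Circle, ℂ)) {u : B}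
    (hu : u ∈ unitary B) :
    ContinuousOn (Function.extend (fun z : Circle => (z : ℂ)) h 0) (spectrum ℂ u) :=
  (continuousOn_extend h).mono (spectrum.subset_circle_of_unitary hu)

theorem isStarNormal_of_unitary {B : Type*} [CStarAlgebra B] {u : B} (hu : u ∈ unitary B) :
    IsStarNormal u :=
  ⟨by rw [Commute, SemiconjBy, Unitary.star_mul_self_of_mem hu, Unitary.mul_star_self_of_mem hu]⟩

theorem continuous_hom {A B : Type*} [CStarAlgebra A] [CStarAlgebra B] (φ : A →⋆ₐ[ℂ] B) :
    Continuous φ :=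
  AddMonoidHomClass.continuous_of_bound φ 1 fun x => by
    rw [one_mul]
    exact NonUnitalStarAlgHom.norm_apply_le φ x

theorem map_funOf {A B : Type*} [CStarAlgebra A] [CStarAlgebra B] (φ : A →⋆ₐ[ℂ] B)
    (h : C(Circle, ℂ)) {u : A} (hu : u ∈ unitary A) : φ (funOf h u) = funOf h (φ u) := by
  have hφu : φ u ∈ unitary B := Unitary.map_mem φ hu
  exact StarAlgHomClass.map_cfc φ _ u (continuousOn_spectrum h hu) (continuous_hom φ)
    (isStarNormal_of_unitary hu) (isStarNormal_of_unitary hφu)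

theorem funOf_mem_unitary {B : Type*} [CStarAlgebra B] (f : C(Circle, Circle)) {u : B}
    (hu : u ∈ unitary B) : funOf (toComplex f) u ∈ unitary B := by
  refine (cfc_unitary_iff _ u (isStarNormal_of_unitary hu)
    (continuousOn_spectrum _ hu)).2 fun z hz => ?_
  obtain ⟨w, rfl⟩ := mem_circle_of_spectrum hu hz
  rw [extend_coe]
  simp [toComplex, ← Complex.normSq_eq_conj_mul_self]

theorem funOf_commute {B : Type*} [CStarAlgebra B] (h : C(Circle, ℂ)) {u : B}
    (hu : u ∈ unitary B) : funOf h u * u = u * funOf h u := by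
  have := isStarNormal_of_unitary hu
  have h2 := cfc_commute_cfc (Function.extend (fun z : Circle => (z : ℂ)) h 0) (id : ℂ → ℂ) u
  rw [cfc_id ℂ u] at h2
  exact h2

/-! ### The noncommutative 2-torus -/

/-- A pair of unitaries `u, v` with `u v = e^{2πiα} v u` in a nonzero unital C⋆-algebra. -/
structure Rep.{w} (α : ℝ) : Type (w + 1) where
  carrier : Type w
  [cstar : CStarAlgebra carrier]
  [nontriv : Nontrivial carrier]
  u : carrier
  v : carrier
  u_mem : u ∈ unitary carrier
  v_mem : v ∈ unitary carrier
  comm : u * v = Complex.exp (2 * Real.pi * Complex.I * α) • (v * u)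

attribute [instance] Rep.cstar Rep.nontriv

/-- The C⋆-algebra of bounded families indexed by all such pairs, with the supremum norm. -/
abbrev Ambient.{w} (α : ℝ) : Type (w + 1) := lp (fun i : Rep.{w} α => i.carrier) ∞

instance ambientCStarAlgebra.{w} (α : ℝ) : CStarAlgebra (Ambient.{w} α) where
  norm_mul_self_le x := CStarRing.norm_star_mul_self (x := x) |>.symm.le

theorem memℓp_of_unitary.{w} {α : ℝ} (x : ∀ i : Rep.{w} α, i.carrier)
    (hx : ∀ i, x i ∈ unitary i.carrier) : Memℓp x ∞ :=
  memℓp_infty ⟨1, by rintro _ ⟨i, rfl⟩; exact (CStarRing.norm_of_mem_unitary (hx i)).le⟩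

/-- The universal pair of unitaries, inside the algebra of bounded families. -/
def ambientU.{w} (α : ℝ) : Ambient.{w} α :=
  ⟨fun i => i.u, memℓp_of_unitary _ fun i => i.u_mem⟩

def ambientV.{w} (α : ℝ) : Ambient.{w} α :=
  ⟨fun i => i.v, memℓp_of_unitary _ fun i => i.v_mem⟩

/-- The noncommutative torus as a C⋆-subalgebra of `Ambient α`. -/
def torusSubalgebra.{w} (α : ℝ) : StarSubalgebra ℂ (Ambient.{w} α) :=
  (StarAlgebra.adjoin ℂ {ambientU.{w} α, ambientV.{w} α}).topologicalClosure

instance isClosed_torusSubalgebra.{w} (α : ℝ) :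
    IsClosed (torusSubalgebra.{w} α : Set (Ambient.{w} α)) :=
  StarSubalgebra.isClosed_topologicalClosure _

/-- The noncommutative torus `𝔸_α`: the universal unital C⋆-algebra generated by two unitaries
`U, V` with `U V = e^{2πiα} V U`. Its norm on the polynomials in `U, V, U⋆, V⋆` is the supremum of
the norms in all pairs of unitaries satisfying this relation. -/
abbrev Torus.{w} (α : ℝ) : Type (w + 1) := torusSubalgebra.{w} α

theorem ambientU_mem.{w} (α : ℝ) : ambientU.{w} α ∈ torusSubalgebra.{w} α :=
  StarSubalgebra.le_topologicalClosure _ (StarAlgebra.subset_adjoin ℂ _ (by simp))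

theorem ambientV_mem.{w} (α : ℝ) : ambientV.{w} α ∈ torusSubalgebra.{w} α :=
  StarSubalgebra.le_topologicalClosure _ (StarAlgebra.subset_adjoin ℂ _ (by simp))

/-- The generators `U` and `V` of `𝔸_α`. -/
def U.{w} (α : ℝ) : Torus.{w} α := ⟨ambientU α, ambientU_mem α⟩

def V.{w} (α : ℝ) : Torus.{w} α := ⟨ambientV α, ambientV_mem α⟩

/-- The coordinate homomorphism at a pair `(u, v)`, which maps `U` to `u` and `V` to `v`. -/
def evalAmbient.{w} {α : ℝ} (i : Rep.{w} α) : Ambient.{w} α →⋆ₐ[ℂ] i.carrier where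
  toFun x := x i
  map_one' := rfl
  map_mul' _ _ := rfl
  map_zero' := rfl
  map_add' _ _ := rfl
  commutes' _ := rfl
  map_star' _ := rfl

theorem ambientU_unitary.{w} (α : ℝ) : ambientU.{w} α ∈ unitary (Ambient.{w} α) := by
  rw [Unitary.mem_iff]
  exact ⟨lp.ext (funext fun i => Unitary.star_mul_self_of_mem i.u_mem),
    lp.ext (funext fun i => Unitary.mul_star_self_of_mem i.u_mem)⟩

theorem U_unitary.{w} (α : ℝ) : U.{w} α ∈ unitary (Torus.{w} α) := by
  have h := Unitary.mem_iff.1 (ambientU_unitary.{w} α)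
  exact Unitary.mem_iff.2 ⟨Subtype.ext h.1, Subtype.ext h.2⟩

theorem V_unitary.{w} (α : ℝ) : V.{w} α ∈ unitary (Torus.{w} α) := by
  rw [Unitary.mem_iff]
  exact ⟨Subtype.ext (lp.ext (funext fun i => Unitary.star_mul_self_of_mem i.v_mem)),
    Subtype.ext (lp.ext (funext fun i => Unitary.mul_star_self_of_mem i.v_mem))⟩

theorem U_mul_V.{w} (α : ℝ) :
    U.{w} α * V α = Complex.exp (2 * Real.pi * Complex.I * α) • (V α * U α) :=
  Subtype.ext (lp.ext (funext fun i => i.comm))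

/-- Two `⋆`-homomorphisms out of `𝔸_α` that agree on `U` and `V` are equal. -/
theorem hom_ext.{w, w'} {α : ℝ} {B : Type w'} [CStarAlgebra B] {φ ψ : Torus.{w} α →⋆ₐ[ℂ] B}
    (hU : φ (U α) = ψ (U α)) (hV : φ (V α) = ψ (V α)) : φ = ψ := by
  refine StarAlgHom.ext_topologicalClosure (continuous_hom φ) (continuous_hom ψ) ?_
  refine StarAlgHom.ext_adjoin fun x hx => ?_
  rcases x with ⟨x, hx'⟩
  simp only [Set.mem_insert_iff, Set.mem_singleton_iff] at hx
  rcases hx with rfl | rfl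
  · exact hU
  · exact hV

/-- The universal property of `𝔸_α`. -/
theorem existsUnique_lift.{w} {α : ℝ} {B : Type w} [CStarAlgebra B] {u v : B}
    (hu : u ∈ unitary B) (hv : v ∈ unitary B)
    (huv : u * v = Complex.exp (2 * Real.pi * Complex.I * α) • (v * u)) :
    ∃! φ : Torus.{w} α →⋆ₐ[ℂ] B, φ (U α) = u ∧ φ (V α) = v := by
  have key : ∃ φ : Torus.{w} α →⋆ₐ[ℂ] B, φ (U α) = u ∧ φ (V α) = v := by
    rcases subsingleton_or_nontrivial B with h | h
    · exact ⟨{ toFun := fun _ => 0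
               map_one' := Subsingleton.elim _ _
               map_mul' := fun _ _ => Subsingleton.elim _ _
               map_zero' := rfl
               map_add' := fun _ _ => Subsingleton.elim _ _
               commutes' := fun _ => Subsingleton.elim _ _
               map_star' := fun _ => Subsingleton.elim _ _ },
        Subsingleton.elim _ _, Subsingleton.elim _ _⟩
    · exact ⟨(evalAmbient ⟨B, u, v, hu, hv, huv⟩).comp (torusSubalgebra α).subtype, rfl, rfl⟩
  obtain ⟨φ, h⟩ := key
  exact ⟨φ, h, fun ψ hψ => hom_ext (hψ.1.trans h.1.symm) (hψ.2.trans h.2.symm)⟩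

/-! ### The Anzai skew-product -/

/-- The pair `(e^{iθ} u, f(u) v)`, which satisfies the same relations as `(u, v)`. -/
def Rep.skew.{w} {α : ℝ} (θ : ℝ) (f : C(Circle, Circle)) (i : Rep.{w} α) : Rep.{w} α where
  carrier := i.carrier
  u := (Circle.exp θ : ℂ) • i.u
  v := funOf (toComplex f) i.u * i.v
  u_mem := by
    have h := Unitary.mem_iff.1 i.u_mem
    have e : (starRingEnd ℂ) (Circle.exp θ : ℂ) * (Circle.exp θ : ℂ) = 1 := by
      rw [← Complex.normSq_eq_conj_mul_self, Circle.normSq_coe, Complex.ofReal_one]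
    rw [Unitary.mem_iff]
    constructor
    · rw [star_smul, smul_mul_smul_comm, h.1, Complex.star_def, e, one_smul]
    · rw [star_smul, smul_mul_smul_comm, h.2, Complex.star_def, mul_comm, e, one_smul]
  v_mem := mul_mem (funOf_mem_unitary f i.u_mem) i.v_mem
  comm := by
    rw [smul_mul_assoc, ← mul_assoc, ← funOf_commute _ i.u_mem, mul_assoc, i.comm,
      mul_smul_comm, mul_smul_comm, smul_comm, ← mul_assoc]

/-- The map `x ↦ (x_{(e^{iθ}u, f(u)v)})_{(u,v)}` on bounded families. -/
def ambientSkew.{w} (α θ : ℝ) (f : C(Circle, Circle)) :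
    Ambient.{w} α →⋆ₐ[ℂ] Ambient.{w} α where
  toFun x := ⟨fun i => (x (i.skew θ f) : (i.skew θ f).carrier),
    memℓp_infty ⟨‖x‖, by
      rintro _ ⟨i, rfl⟩
      exact lp.norm_apply_le_norm ENNReal.top_ne_zero x (i.skew θ f)⟩⟩
  map_one' := rfl
  map_mul' _ _ := rfl
  map_zero' := rfl
  map_add' _ _ := rfl
  commutes' _ := rfl
  map_star' _ := rfl

theorem coe_funOf_U.{w} (α : ℝ) (h : C(Circle, ℂ)) :
    ((funOf h (U.{w} α) : Torus.{w} α) : Ambient.{w} α) = funOf h (ambientU.{w} α) :=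
  map_funOf (torusSubalgebra.{w} α).subtype h (U_unitary α)

theorem funOf_ambientU_apply.{w} {α : ℝ} (h : C(Circle, ℂ)) (i : Rep.{w} α) :
    (funOf h (ambientU.{w} α) : Ambient.{w} α) i = funOf h i.u :=
  map_funOf (evalAmbient i) h (ambientU_unitary α)

theorem ambientSkew_U.{w} (α θ : ℝ) (f : C(Circle, Circle)) :
    ambientSkew.{w} α θ f (ambientU α) = ((Circle.exp θ : ℂ) • U.{w} α : Torus.{w} α) := rfl

theorem ambientSkew_V.{w} (α θ : ℝ) (f : C(Circle, Circle)) :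
    ambientSkew.{w} α θ f (ambientV α) = (funOf (toComplex f) (U.{w} α) * V α : Torus.{w} α) := by
  change _ = (funOf (toComplex f) (U.{w} α) : Torus.{w} α).1 * ambientV α
  rw [coe_funOf_U]
  refine lp.ext (funext fun i => ?_)
  change funOf (toComplex f) i.u * i.v = (funOf (toComplex f) (ambientU.{w} α) : Ambient.{w} α) i * i.v
  rw [funOf_ambientU_apply]

theorem ambientSkew_mem.{w} (α θ : ℝ) (f : C(Circle, Circle)) (x : Torus.{w} α) :
    ambientSkew.{w} α θ f x ∈ torusSubalgebra.{w} α := by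
  have h : torusSubalgebra.{w} α ≤ (torusSubalgebra.{w} α).comap (ambientSkew.{w} α θ f) := by
    refine StarSubalgebra.topologicalClosure_minimal ?_
      ((isClosed_torusSubalgebra α).preimage (continuous_hom (ambientSkew.{w} α θ f)))
    refine StarAlgebra.adjoin_le ?_
    rintro y (rfl | rfl)
    · change ambientSkew.{w} α θ f (ambientU α) ∈ torusSubalgebra.{w} α
      rw [ambientSkew_U]; exact Subtype.property _
    · change ambientSkew.{w} α θ f (ambientV α) ∈ torusSubalgebra.{w} α
      rw [ambientSkew_V]; exact Subtype.property _
  exact h x.2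

/-- The unital `⋆`-homomorphism of `𝔸_α` with `U ↦ e^{iθ} U` and `V ↦ f(U) V`. -/
def skewHom.{w} (α θ : ℝ) (f : C(Circle, Circle)) : Torus.{w} α →⋆ₐ[ℂ] Torus.{w} α :=
  StarAlgHom.codRestrict ((ambientSkew.{w} α θ f).comp (torusSubalgebra.{w} α).subtype)
    (torusSubalgebra.{w} α) (ambientSkew_mem α θ f)

theorem skewHom_U.{w} (α θ : ℝ) (f : C(Circle, Circle)) :
    skewHom.{w} α θ f (U α) = (Circle.exp θ : ℂ) • U α := rfl

theorem skewHom_V.{w} (α θ : ℝ) (f : C(Circle, Circle)) :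
    skewHom.{w} α θ f (V α) = funOf (toComplex f) (U α) * V α :=
  Subtype.ext (ambientSkew_V α θ f)

/-- The function `z ↦ conj (f (e^{-iθ} z))`, which gives the inverse skew-product. -/
def skewInv (θ : ℝ) (f : C(Circle, Circle)) : C(Circle, Circle) :=
  ⟨fun z => (f (Circle.exp (-θ) * z))⁻¹, by fun_prop⟩

theorem funOf_smul_mul {B : Type*} [CStarAlgebra B] (θ : ℝ) (f g : C(Circle, Circle)) {u : B}
    (hu : u ∈ unitary B) (h : ∀ z, g (Circle.exp θ * z) * f z = 1) :
    funOf (toComplex g) ((Circle.exp θ : ℂ) • u) * funOf (toComplex f) u = 1 := by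
  have hn := isStarNormal_of_unitary hu
  have hs : Set.MapsTo (fun z => (Circle.exp θ : ℂ) * z) (spectrum ℂ u)
      (Metric.sphere (0 : ℂ) 1) := by
    intro z hz
    have := spectrum.subset_circle_of_unitary hu hz
    rw [mem_sphere_zero_iff_norm] at this ⊢
    rw [norm_mul, Circle.norm_coe, this, one_mul]
  have hc : ContinuousOn (fun z => Function.extend (fun z : Circle => (z : ℂ)) (toComplex g) 0
      ((Circle.exp θ : ℂ) * z)) (spectrum ℂ u) :=
    (continuousOn_extend _).comp (by fun_prop) hs
  have h1 : funOf (toComplex g) ((Circle.exp θ : ℂ) • u) =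
      cfc (fun z => Function.extend (fun z : Circle => (z : ℂ)) (toComplex g) 0
        ((Circle.exp θ : ℂ) * z)) u :=
    (cfc_comp_const_mul _ _ u ((continuousOn_extend _).mono hs.image_subset) hn).symm
  rw [h1, funOf, ← cfc_mul _ _ u hc (continuousOn_spectrum _ hu), ← cfc_one ℂ u]
  refine cfc_congr fun z hz => ?_
  obtain ⟨w, rfl⟩ := mem_circle_of_spectrum hu hz
  have := congrArg (fun c : Circle => (c : ℂ)) (h w)
  change Function.extend (fun z : Circle => (z : ℂ)) (toComplex g) 0
    ((Circle.exp θ * w : Circle) : ℂ) *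
    Function.extend (fun z : Circle => (z : ℂ)) (toComplex f) 0 (w : ℂ) = 1
  rw [extend_coe, extend_coe]
  exact this

theorem skewHom_skewHom.{w} (α θ θ' : ℝ) (f g : C(Circle, Circle)) (hθ : θ + θ' = 0)
    (h : ∀ z, g (Circle.exp θ * z) * f z = 1) (x : Torus.{w} α) :
    skewHom.{w} α θ f (skewHom.{w} α θ' g x) = x := by
  have key : (skewHom.{w} α θ f).comp (skewHom.{w} α θ' g) = StarAlgHom.id ℂ (Torus.{w} α) := by
    refine hom_ext ?_ ?_
    · rw [StarAlgHom.comp_apply, skewHom_U, map_smul, skewHom_U, smul_smul, ← Circle.coe_mul,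
        ← Circle.exp_add, add_comm, hθ, Circle.exp_zero, Circle.coe_one, one_smul]
      rfl
    · rw [StarAlgHom.comp_apply, skewHom_V, map_mul, map_funOf _ _ (U_unitary α), skewHom_U,
        skewHom_V, ← mul_assoc, funOf_smul_mul θ f g (U_unitary α) h, one_mul]
      rfl
  exact DFunLike.congr_fun key x

/-- The Anzai skew-product `Φ_{θ,f}`: the `⋆`-automorphism of `𝔸_α` with `U ↦ e^{iθ} U` and
`V ↦ f(U) V`. -/
def anzai.{w} (α θ : ℝ) (f : C(Circle, Circle)) : Torus.{w} α ≃⋆ₐ[ℂ] Torus.{w} α :=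
  StarAlgEquiv.ofStarAlgHom (skewHom α θ f) (skewHom α (-θ) (skewInv θ f))
    (StarAlgHom.ext fun x => skewHom_skewHom α (-θ) θ (skewInv θ f) f (neg_add_cancel θ)
      (fun z => mul_inv_cancel (f (Circle.exp (-θ) * z))) x)
    (StarAlgHom.ext fun x => skewHom_skewHom α θ (-θ) f (skewInv θ f) (add_neg_cancel θ)
      (fun z => by
        change (f (Circle.exp (-θ) * (Circle.exp θ * z)))⁻¹ * f z = 1
        rw [← mul_assoc, ← Circle.exp_add, neg_add_cancel, Circle.exp_zero, one_mul,
          inv_mul_cancel]) x)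

theorem anzai_U.{w} (α θ : ℝ) (f : C(Circle, Circle)) :
    anzai.{w} α θ f (U α) = Complex.exp (θ * Complex.I) • U α := by
  rw [← Circle.coe_exp]
  exact skewHom_U α θ f

theorem anzai_V.{w} (α θ : ℝ) (f : C(Circle, Circle)) :
    anzai.{w} α θ f (V α) = funOf (toComplex f) (U α) * V α :=
  skewHom_V α θ f

/-! ### Topological ergodicity and the cohomological equation -/

/-- The fixed-point subalgebra of a `⋆`-automorphism. -/
def fixedPoints {A : Type*} [CStarAlgebra A] (Φ : A ≃⋆ₐ[ℂ] A) : StarSubalgebra ℂ A where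
  carrier := {a | Φ a = a}
  mul_mem' ha hb := by rw [Set.mem_ofPred_eq, map_mul, ha, hb]
  add_mem' ha hb := by rw [Set.mem_ofPred_eq, map_add, ha, hb]
  algebraMap_mem' c := by
    rw [Set.mem_ofPred_eq, Algebra.algebraMap_eq_smul_one, map_smul, map_one]
  star_mem' ha := by rw [Set.mem_ofPred_eq, map_star, ha]

/-- Topological ergodicity: the fixed-point subalgebra consists of the scalar multiples of `1`. -/
def TopologicallyErgodic {A : Type*} [CStarAlgebra A] (Φ : A ≃⋆ₐ[ℂ] A) : Prop :=
  (fixedPoints Φ : Set A) = {a | ∃ c : ℂ, a = c • (1 : A)}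

/-- The functions `f_n`: `∏_{l=0}^{n-1} f ∘ R_{-lα}` for `n ≥ 0` (the empty product `1` for `n = 0`)
and `∏_{l=1}^{|n|} conj (f ∘ R_{lα})` for `n < 0`. -/
def cocycle (α : ℝ) (f : C(Circle, Circle)) : ℤ → Circle → ℂ
  | Int.ofNat n, z => ∏ l ∈ Finset.range n, (f (rot (-(l * α)) z) : ℂ)
  | Int.negSucc m, z => ∏ l ∈ Finset.Icc 1 (m + 1), conj (f (rot (l * α) z) : ℂ)

/-- The cohomological equation `(g ∘ R_{θ/2π}) f_n = g` for `g ∈ C(𝕋)`. -/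
def SolvesCohomological (α θ : ℝ) (f : C(Circle, Circle)) (n : ℤ) (g : C(Circle, ℂ)) : Prop :=
  ∀ z : Circle, g (rot (θ / (2 * Real.pi)) z) * cocycle α f n z = g z

end NCTorus

end

universe w

/-!
The gauge action `U ↦ U`, `V ↦ e^{2πit} V` grades `𝔸_α` by the closed subspaces `{g(U) Vⁿ}`, and
the `n`-th Fourier coefficient of the gauge orbit of `a` is the `n`-th component of `a`; an element
all of whose components vanish is `0`. Since `Φ (g(U) Vⁿ) = ((g ∘ R_{θ/2π}) f_n)(U) Vⁿ`, the
skew-product preserves this grading, so `a` is fixed if and only if each of its components is, and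
the component `g(U) Vⁿ` is fixed if and only if `g` solves the `n`-th cohomological equation. For
`n = 0` that equation says that `g` is invariant under an irrational rotation, hence constant.
-/

noncomputable section

namespace NCTorus

section FunctionalCalculus

variable {B : Type*} [CStarAlgebra B] {u : B}

/-- The `⋆`-homomorphism `h ↦ h(u)` on `C(𝕋)` attached to a unitary `u`: restriction to the spectrum
of `u`, followed by Mathlib's functional calculus. -/
def funOfHom (hu : u ∈ unitary B) : C(Circle, ℂ) →⋆ₐ[ℂ] B :=
  (cfcHom (isStarNormal_of_unitary hu)).comp <| ContinuousMap.compStarAlgHom' ℂ ℂ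
    ⟨fun z : spectrum ℂ u => ⟨z, spectrum.subset_circle_of_unitary hu z.2⟩, by fun_prop⟩

theorem funOfHom_apply (hu : u ∈ unitary B) (h : C(Circle, ℂ)) : funOfHom hu h = funOf h u := by
  rw [funOf, cfc_apply _ u (isStarNormal_of_unitary hu) (continuousOn_spectrum h hu)]
  refine congrArg (cfcHom (isStarNormal_of_unitary hu)) (ContinuousMap.ext fun z => ?_)
  exact (extend_coe h ⟨z, spectrum.subset_circle_of_unitary hu z.2⟩).symm

theorem funOfHom_injective (hu : u ∈ unitary B) (hs : ∀ z : Circle, (z : ℂ) ∈ spectrum ℂ u) :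
    Function.Injective (funOfHom hu) := by
  intro h k hhk
  ext z
  have heq := cfcHom_injective (isStarNormal_of_unitary hu) hhk
  exact DFunLike.congr_fun heq ⟨z, hs z⟩

theorem funOf_mul (hu : u ∈ unitary B) (h k : C(Circle, ℂ)) :
    funOf (h * k) u = funOf h u * funOf k u := by
  simp only [← funOfHom_apply hu, map_mul]

theorem funOf_toComplex_id (hu : u ∈ unitary B) :
    funOf (toComplex (ContinuousMap.id Circle)) u = u := by
  have hid : Set.EqOn (Function.extend (fun z : Circle => (z : ℂ)) (toComplex (.id Circle)) 0) id
      (spectrum ℂ u) := fun z hz => by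
    obtain ⟨w, rfl⟩ := mem_circle_of_spectrum hu hz
    exact extend_coe _ w
  have := isStarNormal_of_unitary hu
  rw [funOf, cfc_congr hid, cfc_id ℂ u]

theorem funOf_toComplex_const (hu : u ∈ unitary B) (c : Circle) :
    funOf (toComplex (ContinuousMap.const Circle c)) u = (c : ℂ) • (1 : B) := by
  rw [← Algebra.algebraMap_eq_smul_one, ← AlgHomClass.commutes (funOfHom hu), funOfHom_apply]
  rfl

theorem funOf_smul (hu : u ∈ unitary B) (c : Circle) (h : C(Circle, ℂ)) :
    funOf h ((c : ℂ) • u) = funOf (h.comp (ContinuousMap.mulLeft c)) u := by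
  have hmaps : Set.MapsTo (fun z => (c : ℂ) * z) (spectrum ℂ u) (Metric.sphere (0 : ℂ) 1) := by
    intro z hz
    obtain ⟨w, rfl⟩ := mem_circle_of_spectrum hu hz
    exact (c * w).2
  rw [funOf, ← cfc_comp_const_mul _ _ u ((continuousOn_extend _).mono hmaps.image_subset)
    (isStarNormal_of_unitary hu)]
  refine cfc_congr fun z hz => ?_
  obtain ⟨w, rfl⟩ := mem_circle_of_spectrum hu hz
  exact (extend_coe h (c * w)).trans (extend_coe (h.comp (ContinuousMap.mulLeft c)) w).symm

end FunctionalCalculus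

/-! ### Fourier coefficients of vector-valued functions -/

section FourierCoefficients

variable {E F : Type*} [NormedAddCommGroup E] [NormedAddCommGroup F] {T : ℝ} [Fact (0 < T)]

theorem integrable_of_continuous {f : AddCircle T → E} (hf : Continuous f) :
    MeasureTheory.Integrable f AddCircle.haarAddCircle :=
  hf.integrable_of_hasCompactSupport (HasCompactSupport.of_compactSpace f)

variable [NormedSpace ℂ E] [NormedSpace ℂ F]

theorem map_fourierCoeff [CompleteSpace E] [CompleteSpace F] (L : E →L[ℂ] F)
    {f : AddCircle T → E} (hf : Continuous f) (n : ℤ) :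
    L (fourierCoeff f n) = fourierCoeff (fun t => L (f t)) n := by
  simp only [fourierCoeff, ← map_smul]
  exact (L.integral_comp_comm ((integrable_of_continuous hf).fourier_smul (-n))).symm

theorem fourierCoeff_fourier_smul_const [CompleteSpace E] (k : ℤ) (x : E) :
    fourierCoeff (fun t : AddCircle T => fourier k t • x) = Pi.single k x := by
  ext n
  have hcoeff : fourierCoeff (fun t : AddCircle T => fourier k t • x) n =
      fourierCoeff (T := T) (fourier k) n • x := by
    simp only [fourierCoeff, ← smul_assoc]
    exact integral_smul_const _ x
  rw [hcoeff, fourierCoeff_fourier]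
  rcases eq_or_ne n k with rfl | hn
  · simp only [Pi.single_eq_same, one_smul]
  · simp only [Pi.single_eq_of_ne hn, zero_smul]

theorem norm_fourierCoeff_le {f : AddCircle T → E} {C : ℝ} (hf : ∀ t, ‖f t‖ ≤ C) (n : ℤ) :
    ‖fourierCoeff f n‖ ≤ C := by
  refine (MeasureTheory.norm_integral_le_of_norm_le_const (C := C)
    (Filter.Eventually.of_forall fun t => ?_)).trans_eq (by simp)
  rw [norm_smul, fourier_apply, Circle.norm_coe, one_mul]
  exact hf t

theorem eq_zero_of_fourierCoeff_eq_zero [CompleteSpace E] {f : AddCircle T → E}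
    (hf : Continuous f) (h : ∀ n, fourierCoeff f n = 0) (t : AddCircle T) : f t = 0 := by
  refine SeparatingDual.eq_zero_of_forall_dual_eq_zero (R := ℂ) fun L => ?_
  let k : C(AddCircle T, ℂ) := ⟨fun t => L (f t), L.continuous.comp hf⟩
  have hk : fourierCoeff k = 0 :=
    funext fun n => (map_fourierCoeff L hf n).symm.trans (by rw [h, map_zero, Pi.zero_apply])
  have hsum := has_pointwise_sum_fourier_series_of_summable (f := k)
    (by rw [hk]; exact summable_zero) t
  simp only [hk, Pi.zero_apply, zero_smul] at hsum
  exact hsum.unique hasSum_zero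

end FourierCoefficients

/-! ### Spectral decompositions of circle actions -/

/-- The subspaces `W n` are spectral subspaces, for the characters `t ↦ e^{2πint/T}`, of the family
`γ` of linear contractions, and together they span a dense subspace. The group law of `γ` is not
part of the definition: it follows on each `W n`, hence everywhere. -/
structure IsSpectralDecomposition {E : Type*} [NormedAddCommGroup E] [NormedSpace ℂ E] {T : ℝ}
    (γ : AddCircle T → E →ₗ[ℂ] E) (W : ℤ → Submodule ℂ E) : Prop where
  norm_le : ∀ t x, ‖γ t x‖ ≤ ‖x‖
  apply_of_mem : ∀ n, ∀ x ∈ W n, ∀ t, γ t x = fourier n t • x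
  isClosed : ∀ n, IsClosed (W n : Set E)
  dense : Dense ((⨆ n, W n : Submodule ℂ E) : Set E)

namespace IsSpectralDecomposition

variable {E : Type*} [NormedAddCommGroup E] [NormedSpace ℂ E] {T : ℝ}
  {γ : AddCircle T → E →ₗ[ℂ] E} {W : ℤ → Submodule ℂ E}

theorem mem_of_isClosed (hW : IsSpectralDecomposition γ W) {K : Submodule ℂ E}
    (hK : IsClosed (K : Set E)) (hWK : ∀ n, W n ≤ K) (x : E) : x ∈ K := by
  have hle : (⨆ n, W n) ≤ K := iSup_le hWK
  exact closure_minimal hle hK (hW.dense x)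

theorem continuous_apply (hW : IsSpectralDecomposition γ W) (t : AddCircle T) :
    Continuous (γ t) :=
  AddMonoidHomClass.continuous_of_bound (γ t) 1 fun x => by
    rw [one_mul]
    exact hW.norm_le t x

theorem apply_zero (hW : IsSpectralDecomposition γ W) (x : E) : γ 0 x = x :=
  hW.mem_of_isClosed (K := (γ 0).eqLocus LinearMap.id)
    (isClosed_eq (hW.continuous_apply 0) continuous_id)
    (fun n y hy => (hW.apply_of_mem n y hy 0).trans (by rw [fourier_eval_zero, one_smul]; rfl)) x

theorem isClosed_setOf_continuous_orbit (hW : IsSpectralDecomposition γ W) :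
    IsClosed {x | Continuous fun t => γ t x} := by
  refine isClosed_of_closure_subset fun x hx => ?_
  refine continuous_of_uniform_approx_of_continuous fun s hs => ?_
  obtain ⟨ε, hε, hs⟩ := Metric.mem_uniformity_dist.1 hs
  obtain ⟨y, hy, hxy⟩ := Metric.mem_closure_iff.1 hx ε hε
  refine ⟨_, hy, fun t => hs ?_⟩
  rw [dist_eq_norm] at hxy ⊢
  rw [← map_sub]
  exact (hW.norm_le t _).trans_lt hxy

theorem continuous_orbit (hW : IsSpectralDecomposition γ W) (x : E) :
    Continuous fun t => γ t x := by
  let K : Submodule ℂ E :=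
    { carrier := {x | Continuous fun t => γ t x}
      zero_mem' := by
        simp only [Set.mem_ofPred_eq, map_zero]
        exact continuous_const
      add_mem' := fun hx hy => by
        simp only [Set.mem_ofPred_eq, map_add]
        exact hx.add hy
      smul_mem' := fun c x hx => by
        simp only [Set.mem_ofPred_eq, map_smul]
        exact hx.const_smul c }
  refine hW.mem_of_isClosed (K := K) hW.isClosed_setOf_continuous_orbit (fun n y hy => ?_) x
  exact ((fourier n).continuous.smul continuous_const).congr fun t =>
    (hW.apply_of_mem n y hy t).symm

variable [Fact (0 < T)]

/-- The `n`-th spectral component of a vector, i.e. the `n`-th Fourier coefficient of its orbit; as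
a map this is the projection onto `W n` along the other spectral subspaces. -/
def component (hW : IsSpectralDecomposition γ W) (n : ℤ) : E →L[ℂ] E :=
  LinearMap.mkContinuous
    { toFun := fun x => fourierCoeff (fun t => γ t x) n
      map_add' := fun x y => by
        simp only [map_add]
        exact congrFun (fourierCoeff.add (integrable_of_continuous (hW.continuous_orbit x))
          (integrable_of_continuous (hW.continuous_orbit y))) n
      map_smul' := fun c x => by
        simp only [map_smul]
        exact fourierCoeff.const_smul _ c n }
    1 fun x => by
      rw [one_mul]
      exact norm_fourierCoeff_le (fun t => hW.norm_le t x) n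

theorem component_apply (hW : IsSpectralDecomposition γ W) (n : ℤ) (x : E) :
    hW.component n x = fourierCoeff (fun t => γ t x) n := rfl

variable [CompleteSpace E]

theorem component_of_mem (hW : IsSpectralDecomposition γ W) {k : ℤ} {x : E} (hx : x ∈ W k)
    (n : ℤ) : hW.component n x = (Pi.single k x : ℤ → E) n := by
  simp only [component_apply, hW.apply_of_mem k x hx, fourierCoeff_fourier_smul_const]

theorem component_mem (hW : IsSpectralDecomposition γ W) (n : ℤ) (x : E) :
    hW.component n x ∈ W n := by
  refine hW.mem_of_isClosed (K := (W n).comap (hW.component n : E →ₗ[ℂ] E))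
    ((hW.isClosed n).preimage (hW.component n).continuous) (fun k y hy => ?_) x
  rw [Submodule.mem_comap, ContinuousLinearMap.coe_coe, hW.component_of_mem hy]
  rcases eq_or_ne n k with rfl | hn
  · rwa [Pi.single_eq_same]
  · rw [Pi.single_eq_of_ne hn]
    exact zero_mem _

theorem eq_zero_of_component_eq_zero (hW : IsSpectralDecomposition γ W) {x : E}
    (h : ∀ n, hW.component n x = 0) : x = 0 :=
  (hW.apply_zero x).symm.trans (eq_zero_of_fourierCoeff_eq_zero (hW.continuous_orbit x) h 0)

theorem eq_component_of_forall_ne (hW : IsSpectralDecomposition γ W) {k : ℤ} {x : E}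
    (h : ∀ n ≠ k, hW.component n x = 0) : x = hW.component k x := by
  refine sub_eq_zero.1 (hW.eq_zero_of_component_eq_zero fun n => ?_)
  rw [map_sub, hW.component_of_mem (hW.component_mem k x)]
  rcases eq_or_ne n k with rfl | hn
  · rw [Pi.single_eq_same, sub_self]
  · rw [Pi.single_eq_of_ne hn, h n hn, sub_zero]

theorem eq_zero_of_mem_of_mem (hW : IsSpectralDecomposition γ W) {m n : ℤ} (hmn : m ≠ n) {x : E}
    (hm : x ∈ W m) (hn : x ∈ W n) : x = 0 := by
  rw [← Pi.single_eq_same (M := fun _ : ℤ => E) m x, ← hW.component_of_mem hm,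
    hW.component_of_mem hn, Pi.single_eq_of_ne hmn]

theorem map_component (hW : IsSpectralDecomposition γ W) {Φ : E →L[ℂ] E}
    (hΦ : ∀ n, ∀ x ∈ W n, Φ x ∈ W n) (n : ℤ) (x : E) :
    Φ (hW.component n x) = hW.component n (Φ x) := by
  refine hW.mem_of_isClosed (K := (Φ ∘L hW.component n).eqLocus (hW.component n ∘L Φ))
    (isClosed_eq (Φ ∘L hW.component n).continuous (hW.component n ∘L Φ).continuous)
    (fun k y hy => ?_) x
  change Φ (hW.component n y) = hW.component n (Φ y)
  rw [hW.component_of_mem hy, hW.component_of_mem (hΦ k y hy)]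
  exact Pi.apply_single (fun _ => Φ) (fun _ => map_zero Φ) k y n

theorem topologicallyErgodic_iff {A : Type*} [CStarAlgebra A] {γ : AddCircle T → A →ₗ[ℂ] A}
    {W : ℤ → Submodule ℂ A} (hW : IsSpectralDecomposition γ W) (h1 : 1 ∈ W 0) {Φ : A ≃⋆ₐ[ℂ] A}
    (hΦ : ∀ n, ∀ x ∈ W n, Φ x ∈ W n) :
    TopologicallyErgodic Φ ↔ (∀ x ∈ W 0, Φ x = x → ∃ c : ℂ, x = c • (1 : A)) ∧
      ∀ n ≠ 0, ∀ x ∈ W n, Φ x = x → x = 0 := by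
  constructor
  · intro herg
    have hscalar {x : A} (hx : Φ x = x) : ∃ c : ℂ, x = c • (1 : A) := herg.subset hx
    refine ⟨fun x _ hx => hscalar hx, fun n hn x hxn hx => ?_⟩
    obtain ⟨c, rfl⟩ := hscalar hx
    exact hW.eq_zero_of_mem_of_mem hn hxn ((W 0).smul_mem c h1)
  · rintro ⟨hzero, hne⟩
    refine Set.Subset.antisymm (fun a ha => ?_) ?_
    · let ΦL : A →L[ℂ] A := ⟨(Φ : A →ₗ[ℂ] A), continuous_hom (Φ : A →⋆ₐ[ℂ] A)⟩
      have hfix (n : ℤ) : Φ (hW.component n a) = hW.component n a :=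
        (hW.map_component (Φ := ΦL) hΦ n a).trans (congrArg (hW.component n) ha)
      rw [hW.eq_component_of_forall_ne fun n hn => hne n hn _ (hW.component_mem n a) (hfix n)]
      exact hzero _ (hW.component_mem 0 a) (hfix 0)
    · rintro _ ⟨c, rfl⟩
      exact SMulMemClass.smul_mem c (one_mem (fixedPoints Φ))

end IsSpectralDecomposition

/-! ### The cocycle -/

section Cocycle

theorem rot_zero (z : Circle) : rot 0 z = z := by
  rw [rot, mul_zero, Circle.exp_zero, one_mul]

theorem rot_rot (a b : ℝ) (z : Circle) : rot a (rot b z) = rot (a + b) z := by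
  rw [rot, rot, rot, ← mul_assoc, ← Circle.exp_add, mul_add]

/-- The rotation `R_a` as an element of `C(𝕋, 𝕋)`. -/
def rotMap (a : ℝ) : C(Circle, Circle) := ContinuousMap.mulLeft (Circle.exp (2 * Real.pi * a))

theorem rotMap_apply (a : ℝ) (z : Circle) : rotMap a z = rot a z := rfl

variable (α : ℝ) (f : C(Circle, Circle))

theorem cocycle_natCast (n : ℕ) (z : Circle) :
    cocycle α f n z = ∏ l ∈ Finset.range n, (f (rot (-(l * α)) z) : ℂ) := rfl

theorem cocycle_zero (z : Circle) : cocycle α f 0 z = 1 := Finset.prod_range_zero _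

theorem cocycle_neg_natCast (n : ℕ) (z : Circle) :
    cocycle α f (-n) z = ∏ l ∈ Finset.range n, conj (f (rot ((l + 1) * α) z) : ℂ) := by
  cases n with
  | zero => rfl
  | succ m =>
    change ∏ l ∈ Finset.Icc 1 (m + 1), conj (f (rot (l * α) z) : ℂ) = _
    rw [← Finset.Ico_add_one_right_eq_Icc, Finset.prod_Ico_eq_prod_range]
    simp only [add_tsub_cancel_right, Nat.cast_add, Nat.cast_one, add_comm (1 : ℝ)]

theorem cocycle_add_one (n : ℤ) (z : Circle) :
    cocycle α f (n + 1) z = f z * cocycle α f n (rot (-α) z) := by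
  obtain ⟨m, rfl | rfl⟩ := n.eq_nat_or_neg
  · have hshift (l : ℕ) : -(l * α) + -α = -((l + 1 : ℕ) * α) := by push_cast; ring
    rw [← Nat.cast_add_one, cocycle_natCast, cocycle_natCast, Finset.prod_range_succ', mul_comm]
    simp only [rot_rot, hshift, Nat.cast_zero, zero_mul, neg_zero, rot_zero]
  cases m with
  | zero =>
    simp only [Nat.cast_zero, neg_zero, cocycle_zero, zero_add]
    rw [← Nat.cast_one, cocycle_natCast, Finset.prod_range_one, Nat.cast_zero, zero_mul, neg_zero,
      rot_zero, mul_one]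
  | succ m =>
    have hunit : (f z : ℂ) * conj (f z : ℂ) = 1 := by
      rw [Complex.mul_conj, Circle.normSq_coe, Complex.ofReal_one]
    have hshift (l : ℕ) : ((l + 1 : ℕ) + 1) * α + -α = (l + 1) * α := by push_cast; ring
    rw [Nat.cast_add_one, neg_add, neg_add_cancel_right, ← neg_add, ← Nat.cast_add_one,
      cocycle_neg_natCast, cocycle_neg_natCast, Finset.prod_range_succ', mul_left_comm]
    simp only [rot_rot, hshift, Nat.cast_zero, zero_add, one_mul, add_neg_cancel, rot_zero, hunit,
      mul_one]

theorem cocycle_const (c : Circle) (n : ℤ) (z : Circle) :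
    cocycle α (.const Circle c) n z = (c ^ n : Circle) := by
  obtain ⟨m, rfl | rfl⟩ := n.eq_nat_or_neg
  · simp only [cocycle_natCast, ContinuousMap.const_apply, Finset.prod_const, Finset.card_range,
      zpow_natCast, Circle.coe_pow]
  · simp only [cocycle_neg_natCast, ContinuousMap.const_apply, Finset.prod_const,
      Finset.card_range, zpow_neg, zpow_natCast, Circle.coe_inv_eq_conj, Circle.coe_pow, map_pow]

theorem continuous_cocycle (n : ℤ) : Continuous (cocycle α f n) := by
  have hrot (a : ℝ) : Continuous fun z => (f (rot a z) : ℂ) :=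
    (toComplex f).continuous.comp (rotMap a).continuous
  obtain ⟨m, rfl | rfl⟩ := n.eq_nat_or_neg
  · exact continuous_finsetProd _ fun l _ => hrot _
  · simp only [funext (cocycle_neg_natCast α f m)]
    exact continuous_finsetProd _ fun l _ => Complex.continuous_conj.comp (hrot _)

/-- The function `f_n` as an element of `C(𝕋)`. -/
def cocycleMap (n : ℤ) : C(Circle, ℂ) := ⟨cocycle α f n, continuous_cocycle α f n⟩

theorem cocycleMap_zero : cocycleMap α f 0 = 1 := ContinuousMap.ext (cocycle_zero α f)

theorem cocycleMap_add_one (n : ℤ) :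
    cocycleMap α f (n + 1) = toComplex f * (cocycleMap α f n).comp (rotMap (-α)) :=
  ContinuousMap.ext (cocycle_add_one α f n)

end Cocycle

/-! ### Pairs of unitaries commuting up to a phase -/

theorem zpow_smul_eq_of_smul_eq_add_one {G X : Type*} [Group G] [MulAction G X] {g : G} {x : ℤ → X}
    (hx : ∀ n, g • x n = x (n + 1)) (n : ℤ) : g ^ n • x 0 = x n := by
  induction n with
  | zero => rw [zpow_zero, one_smul]
  | succ n ih => rw [add_comm, zpow_one_add, mul_smul, ih, hx, add_comm]
  | pred n ih => rw [sub_eq_neg_add, zpow_add, mul_smul, ih, zpow_neg_one, inv_smul_eq_iff, hx,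
      neg_add_eq_sub, sub_add_cancel]

section UnitaryPairs

variable {B : Type*} [CStarAlgebra B] {α : ℝ} {u v : unitary B}

theorem conj_eq_smul (huv : (u : B) * v = Complex.exp (2 * Real.pi * Complex.I * α) • (v * u)) :
    Unitary.conjStarAlgAut ℂ B v u = (Circle.exp (2 * Real.pi * -α) : ℂ) • (u : B) := by
  have hphase : (Circle.exp (2 * Real.pi * -α) : ℂ) *
      Complex.exp (2 * Real.pi * Complex.I * α) = 1 := by
    rw [Circle.coe_exp, ← Complex.exp_add, Complex.exp_eq_one_iff]
    exact ⟨0, by push_cast; ring⟩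
  have hvu : (v : B) * u = (Circle.exp (2 * Real.pi * -α) : ℂ) • (u * v : B) := by
    rw [huv, smul_smul, hphase, one_smul]
  rw [Unitary.conjStarAlgAut_apply, hvu, smul_mul_assoc, mul_assoc (u : B),
    Unitary.mul_star_self_of_mem v.2, mul_one]

theorem mul_funOf (huv : (u : B) * v = Complex.exp (2 * Real.pi * Complex.I * α) • (v * u))
    (h : C(Circle, ℂ)) : v * funOf h (u : B) = funOf (h.comp (rotMap (-α))) (u : B) * v := by
  have hconj : Unitary.conjStarAlgAut ℂ B v (funOf h (u : B)) =
      funOf (h.comp (rotMap (-α))) (u : B) := by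
    rw [rotMap, ← funOf_smul u.2, ← conj_eq_smul huv]
    exact map_funOf (Unitary.conjStarAlgAut ℂ B v : B →⋆ₐ[ℂ] B) h u.2
  rw [← hconj, Unitary.conjStarAlgAut_apply, mul_assoc _ (star (v : B)), Unitary.coe_star_mul_self,
    mul_one]

theorem zpow_mul_funOf (huv : (u : B) * v = Complex.exp (2 * Real.pi * Complex.I * α) • (v * u))
    (n : ℤ) (h : C(Circle, ℂ)) :
    (v ^ n : unitary B) * funOf h (u : B) =
      funOf (h.comp (rotMap (-(n * α)))) (u : B) * (v ^ n : unitary B) := by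
  have hrec (k : ℤ) : v • (funOf (h.comp (rotMap (-(k * α)))) (u : B) * (v ^ k : unitary B)) =
      funOf (h.comp (rotMap (-((k + 1 : ℤ) * α)))) (u : B) * (v ^ (k + 1) : unitary B) := by
    have hrot : (rotMap (-(k * α))).comp (rotMap (-α)) = rotMap (-((k + 1 : ℤ) * α)) :=
      ContinuousMap.ext fun z => (rot_rot _ _ z).trans
        (congrArg (rot · z) (by push_cast; ring))
    rw [Submonoid.smul_def, smul_eq_mul, ← mul_assoc, mul_funOf huv, ContinuousMap.comp_assoc, hrot,
      mul_assoc, add_comm, zpow_one_add, Submonoid.coe_mul]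
  have hrot : rotMap (-((0 : ℤ) * α)) = .id Circle := ContinuousMap.ext fun z => by
    rw [rotMap_apply, Int.cast_zero, zero_mul, neg_zero, rot_zero, ContinuousMap.id_apply]
  have hzpow := zpow_smul_eq_of_smul_eq_add_one hrec n
  rwa [hrot, ContinuousMap.comp_id, zpow_zero, OneMemClass.coe_one, mul_one] at hzpow

theorem zpow_skew (huv : (u : B) * v = Complex.exp (2 * Real.pi * Complex.I * α) • (v * u))
    {f : C(Circle, Circle)} {w : unitary B} (hw : (w : B) = funOf (toComplex f) (u : B) * v)
    (n : ℤ) :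
    ((w ^ n : unitary B) : B) = funOf (cocycleMap α f n) (u : B) * (v ^ n : unitary B) := by
  have hrec (k : ℤ) : w • (funOf (cocycleMap α f k) (u : B) * (v ^ k : unitary B)) =
      funOf (cocycleMap α f (k + 1)) (u : B) * (v ^ (k + 1) : unitary B) := by
    rw [Submonoid.smul_def, smul_eq_mul, hw, mul_assoc, ← mul_assoc (v : B), mul_funOf huv,
      cocycleMap_add_one, funOf_mul u.2, add_comm k, zpow_one_add, Submonoid.coe_mul]
    simp only [mul_assoc]
  have hzpow := zpow_smul_eq_of_smul_eq_add_one hrec n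
  rw [cocycleMap_zero, ← funOfHom_apply u.2 1, map_one, one_mul, zpow_zero, Submonoid.smul_def,
    OneMemClass.coe_one, smul_eq_mul, mul_one] at hzpow
  exact hzpow

theorem map_funOf_mul_zpow {A : Type*} [CStarAlgebra A] {x y : unitary A} {φ : A →⋆ₐ[ℂ] B}
    {f : C(Circle, Circle)} {a : ℝ}
    (huv : (u : B) * v = Complex.exp (2 * Real.pi * Complex.I * α) • (v * u))
    (hx : φ x = (Circle.exp (2 * Real.pi * a) : ℂ) • (u : B))
    (hy : φ y = funOf (toComplex f) (u : B) * v) (g : C(Circle, ℂ)) (n : ℤ) :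
    φ (funOf g (x : A) * (y ^ n : unitary A)) =
      funOf (g.comp (rotMap a) * cocycleMap α f n) (u : B) * (v ^ n : unitary B) := by
  have hzpow : φ (y ^ n : unitary A) =
      funOf (cocycleMap α f n) (u : B) * (v ^ n : unitary B) := by
    let ψ : A →⋆* B := { (φ : A →* B) with map_star' := map_star φ }
    rw [← zpow_skew huv (w := Unitary.map ψ y) hy n, ← map_zpow]
    rfl
  rw [map_mul, map_funOf φ g x.2, hx, funOf_smul u.2, hzpow, funOf_mul u.2,
    mul_assoc (funOf _ _), rotMap]

/-- The subspace `{g(u) vⁿ : g ∈ C(𝕋)}`, the candidate for the `n`-th spectral subspace of the gauge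
action `u ↦ u`, `v ↦ e^{2πit} v`. -/
def monomialSubspace (u v : unitary B) (n : ℤ) : Submodule ℂ B :=
  LinearMap.range (LinearMap.mulRight ℂ ((v ^ n : unitary B) : B) ∘ₗ
    (funOfHom u.2 : C(Circle, ℂ) →ₗ[ℂ] B))

theorem mem_monomialSubspace {n : ℤ} {x : B} :
    x ∈ monomialSubspace u v n ↔
      ∃ g : C(Circle, ℂ), funOf g (u : B) * (v ^ n : unitary B) = x := by
  simp only [← funOfHom_apply u.2]
  rfl

theorem funOf_mem_monomialSubspace_zero (g : C(Circle, ℂ)) :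
    funOf g (u : B) ∈ monomialSubspace u v 0 :=
  mem_monomialSubspace.2 ⟨g, by rw [zpow_zero, OneMemClass.coe_one, mul_one]⟩

theorem zpow_mem_monomialSubspace (n : ℤ) :
    ((v ^ n : unitary B) : B) ∈ monomialSubspace u v n :=
  mem_monomialSubspace.2 ⟨1, by rw [← funOfHom_apply u.2, map_one, one_mul]⟩

theorem algebraMap_mem_monomialSubspace_zero (c : ℂ) :
    algebraMap ℂ B c ∈ monomialSubspace u v 0 := by
  rw [Algebra.algebraMap_eq_smul_one]
  exact Submodule.smul_mem _ c (zpow_mem_monomialSubspace 0)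

theorem monomialSubspace_mul_le
    (huv : (u : B) * v = Complex.exp (2 * Real.pi * Complex.I * α) • (v * u)) (m n : ℤ) :
    monomialSubspace u v m * monomialSubspace u v n ≤ monomialSubspace u v (m + n) := by
  refine Submodule.mul_le.2 fun x hx y hy => ?_
  obtain ⟨g, rfl⟩ := mem_monomialSubspace.1 hx
  obtain ⟨h, rfl⟩ := mem_monomialSubspace.1 hy
  refine mem_monomialSubspace.2 ⟨g * h.comp (rotMap (-(m * α))), ?_⟩
  rw [mul_assoc, ← mul_assoc _ (funOf h (u : B)), zpow_mul_funOf huv, funOf_mul u.2, zpow_add,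
    Submonoid.coe_mul]
  simp only [mul_assoc]

theorem iSup_monomialSubspace_mul_le
    (huv : (u : B) * v = Complex.exp (2 * Real.pi * Complex.I * α) • (v * u)) :
    (⨆ n, monomialSubspace u v n) * ⨆ n, monomialSubspace u v n ≤ ⨆ n, monomialSubspace u v n := by
  simp only [Submodule.iSup_mul, Submodule.mul_iSup]
  exact iSup_le fun n => iSup_le fun m => (monomialSubspace_mul_le huv m n).trans
    (le_iSup (monomialSubspace u v) (m + n))

theorem adjoin_le_iSup_monomialSubspace
    (huv : (u : B) * v = Complex.exp (2 * Real.pi * Complex.I * α) • (v * u)) {x : B}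
    (hx : x ∈ StarAlgebra.adjoin ℂ {(u : B), (v : B)}) : x ∈ ⨆ n, monomialSubspace u v n := by
  have hmem (n : ℤ) {y : B} (hy : y ∈ monomialSubspace u v n) : y ∈ ⨆ n, monomialSubspace u v n :=
    Submodule.mem_iSup_of_mem n hy
  have hid : funOf (toComplex (.id Circle)) (u : B) = u := funOf_toComplex_id u.2
  have hu : (u : B) ∈ monomialSubspace u v 0 := hid ▸ funOf_mem_monomialSubspace_zero _
  have hu' : star (u : B) ∈ monomialSubspace u v 0 := by
    rw [← hid, ← funOfHom_apply u.2, ← map_star, funOfHom_apply]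
    exact funOf_mem_monomialSubspace_zero _
  have hv : (v : B) ∈ monomialSubspace u v 1 := by
    simpa only [zpow_one] using zpow_mem_monomialSubspace (u := u) (v := v) 1
  have hv' : star (v : B) ∈ monomialSubspace u v (-1) := by
    simpa only [zpow_neg_one, ← Unitary.star_eq_inv, Unitary.coe_star] using
      zpow_mem_monomialSubspace (u := u) (v := v) (-1)
  rw [← StarSubalgebra.mem_toSubalgebra, StarAlgebra.adjoin_toSubalgebra] at hx
  induction hx using Algebra.adjoin_induction with
  | mem y hy =>
    rcases hy with (rfl | rfl) | hy
    · exact hmem 0 hu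
    · exact hmem 1 hv
    rcases hy with hy | hy
    · exact hmem 0 (star_eq_iff_star_eq.1 hy ▸ hu')
    · exact hmem (-1) (star_eq_iff_star_eq.1 hy ▸ hv')
  | algebraMap c => exact hmem 0 (algebraMap_mem_monomialSubspace_zero c)
  | add y z _ _ hy hz => exact add_mem hy hz
  | mul y z _ _ hy hz => exact iSup_monomialSubspace_mul_le huv (Submodule.mul_mem_mul hy hz)

theorem isClosed_monomialSubspace (hs : ∀ z : Circle, (z : ℂ) ∈ spectrum ℂ (u : B)) (n : ℤ) :
    IsClosed (monomialSubspace u v n : Set B) := by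
  have hisom : Isometry fun g : C(Circle, ℂ) => funOfHom u.2 g * (v ^ n : unitary B) :=
    AddMonoidHomClass.isometry_of_norm ((LinearMap.mulRight ℂ ((v ^ n : unitary B) : B)) ∘ₗ
      (funOfHom u.2 : C(Circle, ℂ) →ₗ[ℂ] B)) fun g =>
        (CStarRing.norm_mul_coe_unitary _ _).trans
          (NonUnitalStarAlgHom.norm_map _ (funOfHom_injective u.2 hs) g)
  exact hisom.isClosedEmbedding.isClosed_range

theorem funOf_mul_zpow_injective (hs : ∀ z : Circle, (z : ℂ) ∈ spectrum ℂ (u : B)) (n : ℤ) :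
    Function.Injective fun g : C(Circle, ℂ) => funOf g (u : B) * (v ^ n : unitary B) := by
  intro g h hgh
  have hmul : funOf g (u : B) = funOf h (u : B) := (Unitary.mul_left_inj _).1 hgh
  rw [← funOfHom_apply u.2, ← funOfHom_apply u.2] at hmul
  exact funOfHom_injective u.2 hs hmul

end UnitaryPairs

section SkewProducts

variable {B : Type*} [CStarAlgebra B] {α : ℝ} {u v : unitary B}

theorem map_funOf_mul_zpow_eq_fourier_smul
    (huv : (u : B) * v = Complex.exp (2 * Real.pi * Complex.I * α) • (v * u))
    {t : UnitAddCircle} {φ : B →⋆ₐ[ℂ] B} (hu : φ u = u) (hv : φ v = (t.toCircle : ℂ) • (v : B))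
    (g : C(Circle, ℂ)) (n : ℤ) :
    φ (funOf g (u : B) * (v ^ n : unitary B)) =
      fourier n t • (funOf g (u : B) * (v ^ n : unitary B)) := by
  have hu' : φ u = (Circle.exp (2 * Real.pi * 0) : ℂ) • (u : B) := by
    rw [hu, mul_zero, Circle.exp_zero, Circle.coe_one, one_smul]
  have hv' : φ v = funOf (toComplex (.const Circle t.toCircle)) (u : B) * v := by
    rw [hv, funOf_toComplex_const u.2, smul_one_mul]
  have hg : g.comp (rotMap 0) * cocycleMap α (.const Circle t.toCircle) n =
      (fourier n t : ℂ) • g := ContinuousMap.ext fun z => by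
    change g (rot 0 z) * cocycle α _ n z = fourier n t * g z
    rw [rot_zero, cocycle_const, fourier_apply, AddCircle.toCircle_zsmul, mul_comm]
  rw [map_funOf_mul_zpow huv hu' hv', hg, ← funOfHom_apply u.2, map_smul, funOfHom_apply,
    smul_mul_assoc]

theorem isSpectralDecomposition_monomialSubspace
    (huv : (u : B) * v = Complex.exp (2 * Real.pi * Complex.I * α) • (v * u))
    (hs : ∀ z : Circle, (z : ℂ) ∈ spectrum ℂ (u : B))
    (hdense : Dense (StarAlgebra.adjoin ℂ {(u : B), (v : B)} : Set B))
    {γ : UnitAddCircle → B →⋆ₐ[ℂ] B} (hu : ∀ t, γ t u = u)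
    (hv : ∀ t, γ t v = (t.toCircle : ℂ) • (v : B)) :
    IsSpectralDecomposition (fun t => (γ t).toAlgHom.toLinearMap) (monomialSubspace u v) where
  norm_le t x := NonUnitalStarAlgHom.norm_apply_le (γ t) x
  apply_of_mem n x hx t := by
    obtain ⟨g, rfl⟩ := mem_monomialSubspace.1 hx
    exact map_funOf_mul_zpow_eq_fourier_smul huv (hu t) (hv t) g n
  isClosed := isClosed_monomialSubspace hs
  dense := hdense.mono fun _ => adjoin_le_iSup_monomialSubspace huv

variable {θ : ℝ} {f : C(Circle, Circle)} {Φ : B ≃⋆ₐ[ℂ] B}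

theorem skew_funOf_mul_zpow
    (huv : (u : B) * v = Complex.exp (2 * Real.pi * Complex.I * α) • (v * u))
    (hu : Φ u = (Circle.exp θ : ℂ) • (u : B)) (hv : Φ v = funOf (toComplex f) (u : B) * v)
    (g : C(Circle, ℂ)) (n : ℤ) :
    Φ (funOf g (u : B) * (v ^ n : unitary B)) =
      funOf (g.comp (rotMap (θ / (2 * Real.pi))) * cocycleMap α f n) (u : B) *
        (v ^ n : unitary B) := by
  rw [← mul_div_cancel₀ θ Real.two_pi_pos.ne'] at hu
  exact map_funOf_mul_zpow (φ := (Φ : B →⋆ₐ[ℂ] B)) huv hu hv g n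

theorem skew_funOf_mul_zpow_eq_iff
    (huv : (u : B) * v = Complex.exp (2 * Real.pi * Complex.I * α) • (v * u))
    (hs : ∀ z : Circle, (z : ℂ) ∈ spectrum ℂ (u : B))
    (hu : Φ u = (Circle.exp θ : ℂ) • (u : B)) (hv : Φ v = funOf (toComplex f) (u : B) * v)
    (g : C(Circle, ℂ)) (n : ℤ) :
    Φ (funOf g (u : B) * (v ^ n : unitary B)) = funOf g (u : B) * (v ^ n : unitary B) ↔
      SolvesCohomological α θ f n g := by
  rw [skew_funOf_mul_zpow huv hu hv, (funOf_mul_zpow_injective hs n).eq_iff, ContinuousMap.ext_iff]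
  rfl

theorem topologicallyErgodic_iff_of_skew {γ : UnitAddCircle → B →ₗ[ℂ] B}
    (hW : IsSpectralDecomposition γ (monomialSubspace u v))
    (huv : (u : B) * v = Complex.exp (2 * Real.pi * Complex.I * α) • (v * u))
    (hs : ∀ z : Circle, (z : ℂ) ∈ spectrum ℂ (u : B))
    (hu : Φ u = (Circle.exp θ : ℂ) • (u : B)) (hv : Φ v = funOf (toComplex f) (u : B) * v) :
    TopologicallyErgodic Φ ↔
      (∀ g, SolvesCohomological α θ f 0 g → ∃ c : ℂ, g = c • 1) ∧
        ∀ n ≠ 0, ∀ g, SolvesCohomological α θ f n g → g = 0 := by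
  have hinvariant (n : ℤ) : ∀ x ∈ monomialSubspace u v n, Φ x ∈ monomialSubspace u v n := by
    intro x hx
    obtain ⟨g, rfl⟩ := mem_monomialSubspace.1 hx
    exact mem_monomialSubspace.2 ⟨_, (skew_funOf_mul_zpow huv hu hv g n).symm⟩
  have hone : (1 : B) ∈ monomialSubspace u v 0 := zpow_mem_monomialSubspace 0
  have hscalar (g : C(Circle, ℂ)) (c : ℂ) :
      funOf g (u : B) * (v ^ (0 : ℤ) : unitary B) = c • (1 : B) ↔ g = c • 1 := by
    rw [zpow_zero, OneMemClass.coe_one, mul_one, ← (funOfHom_injective u.2 hs).eq_iff,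
      funOfHom_apply, map_smul, map_one]
  have hzero (g : C(Circle, ℂ)) (n : ℤ) :
      funOf g (u : B) * (v ^ n : unitary B) = 0 ↔ g = 0 := by
    rw [← (funOf_mul_zpow_injective (v := v) hs n).eq_iff, ← funOfHom_apply u.2 0, map_zero,
      zero_mul]
  rw [hW.topologicallyErgodic_iff hone hinvariant]
  simp only [mem_monomialSubspace, forall_exists_index, forall_apply_eq_imp_iff,
    skew_funOf_mul_zpow_eq_iff huv hs hu hv, hscalar, hzero]

end SkewProducts

/-! ### Density and spectrum of the generators -/

section WeightedShift

variable {ι : Type*}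

theorem memℓp_circle_mul_comp {p : ℝ≥0∞} (hp : 0 < p.toReal) {σ : ι → ι}
    (hσ : Function.Injective σ) (c : ι → Circle) {x : ι → ℂ} (hx : Memℓp x p) :
    Memℓp (fun i => (c i : ℂ) * x (σ i)) p := by
  refine memℓp_gen ?_
  simp only [norm_mul, Circle.norm_coe, one_mul]
  exact ((memℓp_gen_iff hp).1 hx).comp_injective hσ

/-- The unitary operator `x ↦ (i ↦ c i * x (σ i))` on `ℓ²(ι)`: a permutation of the coordinates
followed by a diagonal operator. -/
def weightedShift (σ : ι ≃ ι) (c : ι → Circle) :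
    lp (fun _ : ι => ℂ) 2 ≃ₗᵢ[ℂ] lp (fun _ : ι => ℂ) 2 where
  toFun x := ⟨fun i => c i * x (σ i),
    memℓp_circle_mul_comp two_pos σ.injective c (lp.memℓp x)⟩
  invFun x := ⟨fun i => ((c (σ.symm i))⁻¹ : Circle) * x (σ.symm i),
    memℓp_circle_mul_comp two_pos σ.symm.injective _ (lp.memℓp x)⟩
  map_add' x y := lp.ext (funext fun i => mul_add (c i : ℂ) (x (σ i)) (y (σ i)))
  map_smul' r x := lp.ext (funext fun i => mul_left_comm (c i : ℂ) r (x (σ i)))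
  left_inv x := lp.ext (funext fun i => by simp)
  right_inv x := lp.ext (funext fun i => by simp)
  norm_map' x := by
    rw [lp.norm_eq_tsum_rpow two_pos, lp.norm_eq_tsum_rpow two_pos]
    congr 1
    refine Eq.trans (tsum_congr fun i => ?_) (σ.tsum_eq fun i => ‖x i‖ ^ (2 : ℝ≥0∞).toReal)
    change ‖(c i : ℂ) * x (σ i)‖ ^ _ = _
    rw [norm_mul, Circle.norm_coe, one_mul]

end WeightedShift

/-- The pair of a diagonal operator and the bilateral shift on `ℓ²(ℤ)`, a witness that `𝔸_α` is not
zero; `ULift` moves `ℤ` to the universe of the representations of `𝔸_α`. -/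
def shiftRep (α : ℝ) : Rep.{w} α where
  carrier := lp (fun _ : ULift.{w} ℤ => ℂ) 2 →L[ℂ] lp (fun _ : ULift.{w} ℤ => ℂ) 2
  nontriv := by
    let e : lp (fun _ : ULift.{w} ℤ => ℂ) 2 := lp.single 2 ⟨0⟩ 1
    have hsingle : e ≠ 0 := fun h => by
      have h0 := congrArg (fun x : lp (fun _ : ULift.{w} ℤ => ℂ) 2 => x ⟨0⟩) h
      simp [e] at h0
    have := nontrivial_of_ne _ _ hsingle
    infer_instance
  u := Unitary.linearIsometryEquiv.symm
    (weightedShift (Equiv.refl _) fun n : ULift.{w} ℤ => Circle.exp (2 * Real.pi * α * n.down))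
  v := Unitary.linearIsometryEquiv.symm
    (weightedShift (Equiv.ulift.symm.permCongr (Equiv.subRight (1 : ℤ))) 1)
  u_mem := Subtype.property _
  v_mem := Subtype.property _
  comm := by
    ext x n
    change (Circle.exp (2 * Real.pi * α * n.down) : ℂ) *
      (((1 : Circle) : ℂ) * x ⟨n.down - 1⟩) = Complex.exp (2 * Real.pi * Complex.I * α) *
      (((1 : Circle) : ℂ) * (Circle.exp (2 * Real.pi * α * (n.down - 1 : ℤ)) * x ⟨n.down - 1⟩))
    simp only [Circle.coe_one, one_mul, ← mul_assoc, Circle.coe_exp, ← Complex.exp_add]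
    congr 2
    push_cast
    ring

instance nontrivial_torus (α : ℝ) : Nontrivial (Torus.{w} α) :=
  ⟨1, 0, fun h => one_ne_zero (α := (shiftRep.{w} α).carrier)
    (congrArg (fun x : Torus.{w} α => x.1 (shiftRep α)) h)⟩

theorem dense_adjoin_U_V (α : ℝ) :
    Dense (StarAlgebra.adjoin ℂ {U.{w} α, V α} : Set (Torus.{w} α)) := by
  have himage : Subtype.val '' (StarAlgebra.adjoin ℂ {U.{w} α, V α} : Set (Torus.{w} α)) =
      StarAlgebra.adjoin ℂ {ambientU.{w} α, ambientV α} := by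
    have h := StarAlgHom.map_adjoin (torusSubalgebra.{w} α).subtype {U α, V α}
    rw [Set.image_pair] at h
    exact congrArg SetLike.coe h
  exact Subtype.dense_iff.2 (congrArg closure himage).ge

-- The automorphisms `U ↦ cU`, `V ↦ V` make the nonempty spectrum of `U` rotation invariant.
theorem mem_spectrum_U (α : ℝ) (z : Circle) : (z : ℂ) ∈ spectrum ℂ (U.{w} α) := by
  obtain ⟨x, hx⟩ := spectrum.nonempty (U.{w} α)
  obtain ⟨y, rfl⟩ := mem_circle_of_spectrum (U_unitary α) hx
  have hrotate : anzai.{w} α (Complex.arg (z / y : Circle)) 1 (U α) =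
      ((z / y : Circle) : ℂ) • U α := by
    rw [anzai_U, ← Circle.coe_exp, Circle.exp_arg]
  have hspec := AlgEquiv.spectrum_eq (anzai.{w} α (Complex.arg (z / y : Circle)) 1) (U α)
  rw [hrotate, spectrum.smul_eq_smul _ _ ⟨_, hx⟩] at hspec
  rw [← hspec]
  refine ⟨y, hx, ?_⟩
  change ((z / y : Circle) : ℂ) * (y : ℂ) = z
  rw [← Circle.coe_mul, div_mul_cancel]

/-! ### Fixed points of the Anzai skew-product -/

/-- The gauge action `U ↦ U`, `V ↦ e^{2πit} V` of `ℝ/ℤ` on `𝔸_α`, whose spectral subspaces are the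
`{g(U) Vⁿ}`; it is encoded as the skew-product with `θ = 0` and a constant function. -/
def gauge (α : ℝ) (t : UnitAddCircle) : Torus.{w} α →⋆ₐ[ℂ] Torus.{w} α :=
  skewHom α 0 (.const Circle t.toCircle)

theorem gauge_U (α : ℝ) (t : UnitAddCircle) : gauge.{w} α t (U α) = U α := by
  rw [gauge, skewHom_U, Circle.exp_zero, Circle.coe_one]
  exact Subtype.ext (one_smul ℂ (ambientU α))

theorem gauge_V (α : ℝ) (t : UnitAddCircle) :
    gauge.{w} α t (V α) = (t.toCircle : ℂ) • V α := by
  rw [gauge, skewHom_V, funOf_toComplex_const (U_unitary α)]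
  exact smul_one_mul (t.toCircle : ℂ) (V α)

theorem topologicallyErgodic_anzai_iff (α θ : ℝ) (f : C(Circle, Circle)) :
    TopologicallyErgodic (anzai.{w} α θ f) ↔
      (∀ g, SolvesCohomological α θ f 0 g → ∃ c : ℂ, g = c • 1) ∧
        ∀ n ≠ 0, ∀ g, SolvesCohomological α θ f n g → g = 0 := by
  have huv := U_mul_V.{w} α
  have hW := isSpectralDecomposition_monomialSubspace (u := ⟨U.{w} α, U_unitary α⟩)
    (v := ⟨V α, V_unitary α⟩) huv (mem_spectrum_U α) (dense_adjoin_U_V α) (γ := gauge α)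
    (gauge_U α) (gauge_V α)
  exact topologicallyErgodic_iff_of_skew hW huv (mem_spectrum_U α) (skewHom_U α θ f)
    (skewHom_V α θ f)

theorem denseRange_circleExp_zpow {θ : ℝ} (hθ : Irrational (θ / (2 * Real.pi))) :
    DenseRange fun n : ℤ => Circle.exp θ ^ n := by
  have hexp (n : ℤ) : AddCircle.homeomorphCircle' (n • (θ : AddCircle (2 * Real.pi))) =
      Circle.exp θ ^ n := by
    rw [← AddCircle.coe_zsmul, AddCircle.homeomorphCircle'_apply_mk, Circle.exp_zsmul]
  simpa only [Function.comp_def, hexp] using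
    AddCircle.homeomorphCircle'.surjective.denseRange.comp
      (AddCircle.denseRange_zsmul_coe_iff.2 hθ) AddCircle.homeomorphCircle'.continuous

theorem eq_apply_one_of_denseRange_zpow {G X : Type*} [Group G] [TopologicalSpace G]
    [TopologicalSpace X] [T2Space X] {c : G} (hc : DenseRange fun n : ℤ => c ^ n) {g : G → X}
    (hg : Continuous g) (h : ∀ z, g (c * z) = g z) (z : G) : g z = g 1 := by
  have hzpow (n : ℤ) : g (c ^ n) = g 1 := by
    induction n with
    | zero => rw [zpow_zero]
    | succ n ih => rw [add_comm, zpow_one_add, h, ih]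
    | pred n ih => rw [← ih, ← h, ← zpow_one_add, add_sub_cancel]
  exact congrFun (hc.equalizer hg continuous_const (funext hzpow)) z

theorem exists_eq_smul_one_of_solvesCohomological_zero {α θ : ℝ}
    (hθ : Irrational (θ / (2 * Real.pi))) {f : C(Circle, Circle)} {g : C(Circle, ℂ)}
    (hg : SolvesCohomological α θ f 0 g) : ∃ c : ℂ, g = c • 1 := by
  have hinv (z : Circle) : g (Circle.exp θ * z) = g z := by
    simpa only [cocycle_zero, mul_one, rot, mul_div_cancel₀ θ Real.two_pi_pos.ne'] using hg z
  refine ⟨g 1, ContinuousMap.ext fun z => ?_⟩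
  rw [ContinuousMap.smul_apply, ContinuousMap.one_apply, smul_eq_mul, mul_one]
  exact eq_apply_one_of_denseRange_zpow (denseRange_circleExp_zpow hθ) g.continuous hinv z

end NCTorus

end

theorem mainTheorem5 (α θ : ℝ) (hθ : Irrational (θ / (2 * Real.pi))) (f : C(Circle, Circle)) :
    NCTorus.TopologicallyErgodic (NCTorus.anzai.{w} α θ f) ↔
      ∀ n : ℤ, n ≠ 0 →
        ¬ ∃ g : C(Circle, ℂ), g ≠ 0 ∧ NCTorus.SolvesCohomological α θ f n g := by
  open NCTorus in
  have hzero (g : C(Circle, ℂ)) (hg : SolvesCohomological α θ f 0 g) : ∃ c : ℂ, g = c • 1 :=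
    exists_eq_smul_one_of_solvesCohomological_zero hθ hg
  simp only [topologicallyErgodic_anzai_iff, and_iff_right hzero, ne_eq, not_exists, not_and,
    not_imp_not]
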